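/- Let $\mathbb{K}=\mathbb{R}$ or $\mathbb{C}$; all spaces below are over $\mathbb{K}$. For Banach spaces $Y$ and $X$, an into isomorphism $Y\to X$ is a bounded linear operator $T\colon Y\to X$ for which there is $c>0$ with $\|T(y)\|\geq c\|y\|$ for all $y\in Y$. Let $\mathrm{Emb}(Y,X)$ be the set of all into isomorphisms $Y\to X$, with the topology given by the operator norm. Two operators $S,T\in\mathrm{Emb}(Y,X)$ are homotopic in $\mathrm{Emb}(Y,X)$ if there is a continuous map $[0,1]\to\mathrm{Emb}(Y,X)$, $t\mapsto T_t$, with $T_0=S$ and $T_1=T$. A Banach space is hereditarily indecomposable (HI) if it is infinite-dimensional and no two of its closed infinite-dimensional subspaces $U,V$ are in topological direct sum, that is, for no two such subspaces is the map $U\times V\to U+V$, $(u,v)\mapsto u+v$, an isomorphism. A reflection of $Y$ is a bounded operator $R\colon Y\to Y$ for which there are a hyperplane $H\subseteq Y$ and a vector $x_0\in Y\setminus\{0\}$ with $R(x)=x$ for all $x\in H$ and $R(x_0)=-x_0$; an antireflection of $Y$ is an operator $-R$ with $R$ a reflection of $Y$. **Theorem.** Let $X$ be a Banach space, let $Y$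 be a closed subspace of $X$ that is HI, let $\iota\colon Y\to X$ be the inclusion, and let $T\colon Y\to X$ be an into isomorphism. Then at least one of the following holds: $T$ is homotopic in $\mathrm{Emb}(Y,X)$ to $\iota$; or to $-\iota$; or to $\iota\circ R$ for every reflection $R$ of $Y$; or to $\iota\circ A$ for every antireflection $A$ of $Y$. Moreover: 1. if $Y\neq X$, then $T$ is homotopic in $\mathrm{Emb}(Y,X)$ to $\iota$ or to $-\iota$; 2. if $\mathbb{K}=\mathbb{C}$, then $T$ is homotopic in $\mathrm{Emb}(Y,X)$ to $\iota$. Furthermore, if $Z$ is any HI Banach space and $X$ is any Banach space, then $\mathrm{Emb}(Z,X)$ has at most four connected components if $X$ is isomorphic to $Z$, at most two connected components if $X$ is not isomorphic to $Z$, and at most one connected component if $\mathbb{K}=\mathbb{C}$. -/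

import Mathlib

section HereditarilyIndecomposable

variable (𝕜 : Type*) [RCLike 𝕜]
variable {E F : Type*} [NormedAddCommGroup E] [NormedSpace 𝕜 E]
  [NormedAddCommGroup F] [NormedSpace 𝕜 F]

variable {𝕜} in
/-- A bounded operator `T` is an into isomorphism if it is bounded below, that is, if it is an
isomorphism onto its image. -/
def IsIntoIsomorphism (T : E →L[𝕜] F) : Prop :=
  ∃ c : ℝ, 0 < c ∧ ∀ x : E, c * ‖x‖ ≤ ‖T x‖

variable (E F) in
/-- `Emb 𝕜 E F` is the set of all into isomorphisms from `E` to `F`, inside the space of bounded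
operators with the operator norm. -/
def Emb : Set (E →L[𝕜] F) :=
  {T | IsIntoIsomorphism T}

variable {𝕜} in
/-- Two operators are homotopic in `Emb 𝕜 E F` if they are the endpoints of a norm-continuous path
`[0, 1] → Emb 𝕜 E F`. -/
def HomotopicInEmb (S T : E →L[𝕜] F) : Prop :=
  JoinedIn (Emb 𝕜 E F) S T

variable {𝕜} in
/-- Two subspaces are in topological direct sum if `(u, v) ↦ u + v` is an isomorphism from the
product of the two onto their sum. -/
def InTopologicalDirectSum (U V : Submodule 𝕜 E) : Prop :=
  IsIntoIsomorphism (U.subtypeL.coprod V.subtypeL : (U × V) →L[𝕜] E)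

variable {𝕜} in
/-- Closed infinite-dimensional subspaces. -/
def IsInfDimClosedSubspace (U : Submodule 𝕜 E) : Prop :=
  IsClosed (U : Set E) ∧ ¬ FiniteDimensional 𝕜 U

variable (E) in
/-- Hereditarily indecomposable spaces: infinite-dimensional spaces in which no two closed
infinite-dimensional subspaces are in topological direct sum. -/
def IsHereditarilyIndecomposable : Prop :=
  ¬ FiniteDimensional 𝕜 E ∧
    ∀ U V : Submodule 𝕜 E, IsInfDimClosedSubspace U → IsInfDimClosedSubspace V →
      ¬ InTopologicalDirectSum U V

variable {𝕜} in
/-- A reflection is a bounded operator fixing a hyperplane pointwise and sending some nonzero vector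
to its opposite. Such a hyperplane is the kernel of `R - 1`, so it is automatically closed. -/
def IsReflectionOperator (R : E →L[𝕜] E) : Prop :=
  ∃ (H : Submodule 𝕜 E) (x₀ : E), Module.finrank 𝕜 (E ⧸ H) = 1 ∧ x₀ ≠ 0 ∧
    (∀ x ∈ H, R x = x) ∧ R x₀ = -x₀

variable {𝕜} in
/-- An antireflection is the opposite of a reflection. -/
def IsAntireflectionOperator (A : E →L[𝕜] E) : Prop :=
  ∃ R : E →L[𝕜] E, IsReflectionOperator R ∧ A = -R

end HereditarilyIndecomposable

section EmbeddingsOfHereditarilyIndecomposableSpaces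

open Set Filter Topology

/-! ### Into isomorphisms: stability, and homotopies between them. -/

section Basic

variable {𝕜 : Type*} [RCLike 𝕜]
variable {E F G : Type*} [NormedAddCommGroup E] [NormedSpace 𝕜 E]
  [NormedAddCommGroup F] [NormedSpace 𝕜 F] [NormedAddCommGroup G] [NormedSpace 𝕜 G]

/-! The argument compares `T` with a fixed into isomorphism `J` (the inclusion, in the first
statement) first modulo finite codimension, then repairs the finitely many missing dimensions.

On an HI space the operators that are not upper semi-Fredholm are stable under sums
(`not_isUpperSemiFredholm_add`): two such operators are small on infinite-dimensional subspaces `U`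
and `V`, and if their sum were bounded below in finite codimension, `U` and `V` could be chosen in
direct sum. Consequently, if the segment from `T` to `J` leaves the semi-Fredholm operators, so that
`T + aJ` is not semi-Fredholm for some `a > 0`, then the segment from `T` to `-aJ` cannot leave
them. By compactness a semi-Fredholm segment is bounded below on a single subspace of finite
codimension, so there `T` is homotopic to `J` or to `-aJ`, and `-aJ` is homotopic to `-J` on all of
`Y` (`IsHereditarilyIndecomposable.exists_homotopicInEmb_restrict`).

A homotopy on a hyperplane lifts to the whole space up to the sign of the added vector
(`homotopicUpToFlip_of_homotopicInEmb_comp_inl`), that is, up to a reflection. All reflections are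
homotopic and are involutions, so after finitely many lifts at most one reflection survives
(`homotopicInEmb_or_reflection_of_restrict`). This gives the four classes. When the operator is not
onto, the added vector reaches its opposite by passing outside the range; over the complex field it
does so by rotation through `i`, and likewise `-J` is joined to `J`. -/

theorem isIntoIsomorphism_of_norm_le {T : E →L[𝕜] F} (M : ℝ) (h : ∀ x, ‖x‖ ≤ M * ‖T x‖) :
    IsIntoIsomorphism T := by
  -- `M` may be nonpositive when the domain is trivial.
  have hM : 0 < max M 1 := lt_max_of_lt_right one_pos
  refine ⟨(max M 1)⁻¹, inv_pos.2 hM, fun x => ?_⟩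
  rw [inv_mul_le_iff₀ hM]
  exact (h x).trans (mul_le_mul_of_nonneg_right (le_max_left _ _) (norm_nonneg _))

theorem IsIntoIsomorphism.injective {T : E →L[𝕜] F} (h : IsIntoIsomorphism T) :
    Function.Injective T := by
  obtain ⟨c, hc, h⟩ := h
  refine (injective_iff_map_eq_zero T).2 fun x hx => ?_
  have := h x
  rw [hx, norm_zero] at this
  exact norm_le_zero_iff.1 (nonpos_of_mul_nonpos_right this hc)

theorem IsIntoIsomorphism.isClosed_range [CompleteSpace E] {T : E →L[𝕜] F}
    (h : IsIntoIsomorphism T) : IsClosed (range T) := by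
  obtain ⟨c, hc, h⟩ := h
  refine AntilipschitzWith.isClosed_range (K := (Real.toNNReal c⁻¹)) ?_ T.uniformContinuous
  refine AddMonoidHomClass.antilipschitz_of_bound T fun x => ?_
  rw [Real.coe_toNNReal _ (inv_pos.2 hc).le, ← div_eq_inv_mul, le_div_iff₀ hc, mul_comm]
  exact h x

theorem IsIntoIsomorphism.comp {T : F →L[𝕜] G} {S : E →L[𝕜] F}
    (hT : IsIntoIsomorphism T) (hS : IsIntoIsomorphism S) : IsIntoIsomorphism (T ∘L S) := by
  obtain ⟨c, hc, hT⟩ := hT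
  obtain ⟨d, hd, hS⟩ := hS
  refine ⟨c * d, mul_pos hc hd, fun x => ?_⟩
  rw [mul_assoc]
  exact (mul_le_mul_of_nonneg_left (hS x) hc.le).trans (hT _)

theorem isIntoIsomorphism_subtypeL (U : Submodule 𝕜 E) : IsIntoIsomorphism U.subtypeL :=
  ⟨1, one_pos, fun x => by simp⟩

theorem ContinuousLinearEquiv.isIntoIsomorphism (e : E ≃L[𝕜] F) :
    IsIntoIsomorphism (e : E →L[𝕜] F) :=
  isIntoIsomorphism_of_norm_le ‖(e.symm : F →L[𝕜] E)‖ fun x => by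
    simpa using (e.symm : F →L[𝕜] E).le_opNorm (e x)

theorem IsIntoIsomorphism.smul {T : E →L[𝕜] F} (hT : IsIntoIsomorphism T) {a : 𝕜} (ha : a ≠ 0) :
    IsIntoIsomorphism (a • T) := by
  obtain ⟨c, hc, hT⟩ := hT
  refine ⟨‖a‖ * c, mul_pos (norm_pos_iff.2 ha) hc, fun x => ?_⟩
  rw [_root_.smul_apply, norm_smul, mul_assoc]
  exact mul_le_mul_of_nonneg_left (hT x) (norm_nonneg _)

theorem IsIntoIsomorphism.neg {T : E →L[𝕜] F} (hT : IsIntoIsomorphism T) :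
    IsIntoIsomorphism (-T) := by
  obtain ⟨c, hc, hT⟩ := hT
  exact ⟨c, hc, fun x => by simpa using hT x⟩

theorem IsIntoIsomorphism.exists_ball {T : E →L[𝕜] F} (hT : IsIntoIsomorphism T) :
    ∃ ε > 0, ∀ S : E →L[𝕜] F, ‖S‖ < ε → IsIntoIsomorphism (T + S) := by
  obtain ⟨c, hc, hT⟩ := hT
  refine ⟨c, hc, fun S hS => ⟨c - ‖S‖, sub_pos.2 hS, fun x => ?_⟩⟩
  have h1 := hT x
  have h2 := S.le_opNorm x
  have h3 : ‖T x‖ ≤ ‖T x + S x‖ + ‖S x‖ := by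
    simpa using norm_sub_le (T x + S x) (S x)
  rw [_root_.add_apply]
  linarith

theorem isOpen_emb : IsOpen (Emb 𝕜 E F) := by
  refine Metric.isOpen_iff.2 fun T hT => ?_
  obtain ⟨ε, hε, h⟩ := IsIntoIsomorphism.exists_ball hT
  refine ⟨ε, hε, fun S hS => ?_⟩
  have := h (S - T) (by simpa [dist_eq_norm] using hS)
  rwa [add_sub_cancel] at this

theorem homotopicInEmb_of_line {A B : E →L[𝕜] F} (f : ℝ → E →L[𝕜] F) (hf : Continuous f)
    (h0 : f 0 = A) (h1 : f 1 = B) (h : ∀ t ∈ Icc (0 : ℝ) 1, IsIntoIsomorphism (f t)) :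
    HomotopicInEmb A B := by
  refine JoinedIn.ofLine hf.continuousOn h0 h1 ?_
  rintro _ ⟨t, ht, rfl⟩
  exact h t ht

theorem HomotopicInEmb.symm {A B : E →L[𝕜] F} (h : HomotopicInEmb A B) : HomotopicInEmb B A :=
  JoinedIn.symm h

theorem HomotopicInEmb.trans {A B C : E →L[𝕜] F} (h : HomotopicInEmb A B)
    (h' : HomotopicInEmb B C) : HomotopicInEmb A C :=
  JoinedIn.trans h h'

theorem HomotopicInEmb.comp_right {A B : F →L[𝕜] G} (h : HomotopicInEmb A B) {J : E →L[𝕜] F}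
    (hJ : IsIntoIsomorphism J) : HomotopicInEmb (A ∘L J) (B ∘L J) := by
  have hc : Continuous fun T : F →L[𝕜] G => T ∘L J := continuous_id.clm_comp continuous_const
  refine (JoinedIn.map h hc).mono ?_
  rintro _ ⟨T, hT, rfl⟩
  exact IsIntoIsomorphism.comp hT hJ

theorem HomotopicInEmb.comp_left {A B : E →L[𝕜] F} (h : HomotopicInEmb A B) {J : F →L[𝕜] G}
    (hJ : IsIntoIsomorphism J) : HomotopicInEmb (J ∘L A) (J ∘L B) := by
  have hc : Continuous fun T : E →L[𝕜] F => J ∘L T := continuous_const.clm_comp continuous_id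
  refine (JoinedIn.map h hc).mono ?_
  rintro _ ⟨T, hT, rfl⟩
  exact IsIntoIsomorphism.comp hJ hT

theorem IsIntoIsomorphism.eventually_homotopicInEmb {T : E →L[𝕜] F} (hT : IsIntoIsomorphism T) :
    ∀ᶠ S in 𝓝 T, HomotopicInEmb T S := by
  obtain ⟨ε, hε, h⟩ := hT.exists_ball
  refine Metric.eventually_nhds_iff.2 ⟨ε, hε, fun S hS => ?_⟩
  refine homotopicInEmb_of_line (fun t => T + (t : 𝕜) • (S - T))
    (by fun_prop) (by simp) (by simp) ?_
  intro t ht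
  refine h _ ?_
  rw [norm_smul, RCLike.norm_ofReal, abs_of_nonneg ht.1]
  rw [dist_eq_norm] at hS
  exact (mul_le_of_le_one_left (norm_nonneg _) ht.2).trans_lt hS

end Basic

/-! ### Lifting homotopies from `K` to `K × 𝕜`. -/

section OneDimensionalExtension

variable {𝕜 : Type*} [RCLike 𝕜]
variable {K X : Type*} [NormedAddCommGroup K] [NormedSpace 𝕜 K]
  [NormedAddCommGroup X] [NormedSpace 𝕜 X]

/-- The operator on `K × 𝕜` which extends `S` and sends `(0, 1)` to `x`. -/
noncomputable def extendByVector (S : K →L[𝕜] X) (x : X) : K × 𝕜 →L[𝕜] X :=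
  S.coprod (ContinuousLinearMap.toSpanSingleton 𝕜 x)

@[simp]
theorem extendByVector_apply (S : K →L[𝕜] X) (x : X) (p : K × 𝕜) :
    extendByVector S x p = S p.1 + p.2 • x := by
  simp [extendByVector]

@[simp]
theorem extendByVector_comp_inl (S : K →L[𝕜] X) (x : X) :
    extendByVector S x ∘L ContinuousLinearMap.inl 𝕜 K 𝕜 = S := by
  ext k
  simp

theorem extendByVector_comp_inl_apply (A : K × 𝕜 →L[𝕜] X) :
    extendByVector (A ∘L ContinuousLinearMap.inl 𝕜 K 𝕜) (A (0, 1)) = A := by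
  ext p
  · simp
  · simp [Prod.mk_zero_zero]

theorem extendByVector_eq (S : K →L[𝕜] X) (x : X) :
    extendByVector S x = S ∘L ContinuousLinearMap.fst 𝕜 K 𝕜 +
      (ContinuousLinearMap.snd 𝕜 K 𝕜).smulRight x := by
  ext p <;> simp

theorem continuous_extendByVector_left (x : X) :
    Continuous fun S : K →L[𝕜] X => extendByVector S x := by
  simp only [extendByVector_eq]
  exact (continuous_id.clm_comp continuous_const).add continuous_const

theorem continuous_extendByVector_right (S : K →L[𝕜] X) :
    Continuous fun x : X => extendByVector S x := by
  simp only [extendByVector_eq]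
  exact continuous_const.add
    ((ContinuousLinearMap.smulRightL 𝕜 (K × 𝕜) X (ContinuousLinearMap.snd 𝕜 K 𝕜)).continuous)

/-- The range of `S` is closed, so `x` lies at a distance `d > 0` from it. This bounds the scalar
coordinate by `d⁻¹` times the norm of the image, and the lower bound for `S` then controls the other
coordinate. -/
theorem isIntoIsomorphism_extendByVector [CompleteSpace K] {S : K →L[𝕜] X}
    (hS : IsIntoIsomorphism S) {x : X} (hx : x ∉ range S) :
    IsIntoIsomorphism (extendByVector S x) := by
  have hd : 0 < Metric.infDist x (range S) :=
    (hS.isClosed_range.notMem_iff_infDist_pos (range_nonempty S)).1 hx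
  set d := Metric.infDist x (range S) with hd_def
  obtain ⟨c, hc, hS⟩ := hS
  have key : ∀ p : K × 𝕜, d * ‖p.2‖ ≤ ‖S p.1 + p.2 • x‖ := by
    rintro ⟨k, l⟩
    by_cases hl : l = 0
    · simp [hl]
    have h1 : d ≤ dist x (S (-(l⁻¹ • k))) := Metric.infDist_le_dist_of_mem (mem_range_self _)
    have h2 : S k + l • x = l • (x - S (-(l⁻¹ • k))) := by
      simp [smul_smul, hl, add_comm]
    rw [dist_eq_norm] at h1
    rw [h2, norm_smul, mul_comm]
    exact mul_le_mul_of_nonneg_left h1 (norm_nonneg _)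
  refine isIntoIsomorphism_of_norm_le (max (c⁻¹ * (1 + ‖x‖ / d)) d⁻¹) fun p => ?_
  rw [extendByVector_apply, Prod.norm_def]
  set N := ‖S p.1 + p.2 • x‖ with hN
  have hN0 : 0 ≤ N := norm_nonneg _
  have h1 : ‖p.2‖ ≤ d⁻¹ * N := by
    rw [← div_eq_inv_mul, le_div_iff₀ hd, mul_comm]
    exact key p
  have h2 : ‖p.1‖ ≤ c⁻¹ * (1 + ‖x‖ / d) * N := by
    rw [mul_assoc, ← div_eq_inv_mul, le_div_iff₀ hc, mul_comm]
    have h3 : ‖S p.1‖ ≤ N + ‖p.2‖ * ‖x‖ := by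
      have := norm_sub_le (S p.1 + p.2 • x) (p.2 • x)
      rwa [add_sub_cancel_right, norm_smul] at this
    have h4 : ‖p.2‖ * ‖x‖ ≤ d⁻¹ * N * ‖x‖ := mul_le_mul_of_nonneg_right h1 (norm_nonneg _)
    have h5 : (1 + ‖x‖ / d) * N = N + d⁻¹ * N * ‖x‖ := by ring
    linarith [hS p.1]
  refine max_le (h2.trans ?_) (h1.trans ?_)
  · exact mul_le_mul_of_nonneg_right (le_max_left _ _) hN0
  · exact mul_le_mul_of_nonneg_right (le_max_right _ _) hN0

theorem isIntoIsomorphism_inl : IsIntoIsomorphism (ContinuousLinearMap.inl 𝕜 K 𝕜) :=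
  ⟨1, one_pos, fun x => by simp⟩

theorem IsIntoIsomorphism.apply_notMem_range_comp_inl {A : K × 𝕜 →L[𝕜] X}
    (hA : IsIntoIsomorphism A) :
    A (0, 1) ∉ range (A ∘L ContinuousLinearMap.inl 𝕜 K 𝕜) := by
  rintro ⟨k, hk⟩
  have := hA.injective hk
  simp at this

theorem homotopicInEmb_extendByVector_of_segment [CompleteSpace K] {S : K →L[𝕜] X}
    (hS : IsIntoIsomorphism S) {x y : X}
    (h : ∀ t ∈ Icc (0 : ℝ) 1, ((1 - t : ℝ) : 𝕜) • x + (t : 𝕜) • y ∉ range S) :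
    HomotopicInEmb (extendByVector S x) (extendByVector S y) := by
  refine homotopicInEmb_of_line
    (fun t : ℝ => extendByVector S (((1 - t : ℝ) : 𝕜) • x + (t : 𝕜) • y))
    ((continuous_extendByVector_right S).comp ?_) (by simp) (by simp)
    fun t ht => isIntoIsomorphism_extendByVector hS (h t ht)
  exact ((RCLike.continuous_ofReal.comp (continuous_const.sub continuous_id)).smul
    continuous_const).add (RCLike.continuous_ofReal.smul continuous_const)

/-- The segments from `x` to `y` and from `x` to `-y` cannot both meet the subspace `range S`:
eliminating `y` between the two points would put a multiple of `x` in it. -/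
theorem homotopicInEmb_extendByVector_or_neg [CompleteSpace K] {S : K →L[𝕜] X}
    (hS : IsIntoIsomorphism S) {x y : X} (hx : x ∉ range S) (hy : y ∉ range S) :
    HomotopicInEmb (extendByVector S x) (extendByVector S y) ∨
      HomotopicInEmb (extendByVector S x) (extendByVector S (-y)) := by
  by_cases h : ∀ t ∈ Icc (0 : ℝ) 1, ((1 - t : ℝ) : 𝕜) • x + (t : 𝕜) • y ∉ range S
  · exact Or.inl (homotopicInEmb_extendByVector_of_segment hS h)
  right
  push Not at h
  obtain ⟨t, ⟨ht0, ht1⟩, hmem⟩ := h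
  have hmem' : ((1 - t : ℝ) : 𝕜) • x + (t : 𝕜) • y ∈ S.range := by simpa using hmem
  have hx' : x ∉ S.range := by simpa using hx
  have hy' : y ∉ S.range := by simpa using hy
  refine homotopicInEmb_extendByVector_of_segment hS fun u hu hmem2 => ?_
  have hmem2' : ((1 - u : ℝ) : 𝕜) • x + (u : 𝕜) • (-y) ∈ S.range := by simpa using hmem2
  have h1 : ((1 - u) * t + u * (1 - t) : ℝ) ≠ 0 → False := by
    intro hne
    apply hx'
    have := S.range.add_mem (S.range.smul_mem (u : 𝕜) hmem')
      (S.range.smul_mem (t : 𝕜) hmem2')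
    have e : (u : 𝕜) • (((1 - t : ℝ) : 𝕜) • x + (t : 𝕜) • y) +
        (t : 𝕜) • (((1 - u : ℝ) : 𝕜) • x + (u : 𝕜) • (-y)) =
        (((1 - u) * t + u * (1 - t) : ℝ) : 𝕜) • x := by
      push_cast
      module
    rw [e] at this
    exact (S.range.smul_mem_iff (by exact_mod_cast hne)).1 this
  -- The coefficient of `x` is a sum of two nonnegative terms. It vanishes only if `t = u = 0` or `t
  -- = u = 1`, and then an endpoint lies in the range.
  have h2 : (1 - u) * t + u * (1 - t) = 0 := by
    by_contra hne
    exact h1 hne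
  have h3 : (1 - u) * t = 0 := by
    nlinarith [mul_nonneg (sub_nonneg.2 hu.2) ht0, mul_nonneg hu.1 (sub_nonneg.2 ht1)]
  have h4 : u * (1 - t) = 0 := by linarith
  rcases mul_eq_zero.1 h3 with h5 | h5
  · have hu1 : u = 1 := by linarith
    subst hu1
    apply hy'
    simpa using hmem2'
  · subst h5
    apply hx'
    simpa using hmem'

variable (𝕜 K) in
/-- The reflection `(k, a) ↦ (k, -a)`. -/
noncomputable def flipSecond : K × 𝕜 →L[𝕜] K × 𝕜 :=
  (ContinuousLinearMap.fst 𝕜 K 𝕜).prod (-ContinuousLinearMap.snd 𝕜 K 𝕜)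

@[simp]
theorem flipSecond_apply (p : K × 𝕜) : flipSecond 𝕜 K p = (p.1, -p.2) := rfl

theorem isIntoIsomorphism_flipSecond : IsIntoIsomorphism (flipSecond 𝕜 K) :=
  ⟨1, one_pos, fun x => by simp [Prod.norm_def]⟩

theorem flipSecond_comp_flipSecond :
    flipSecond 𝕜 K ∘L flipSecond 𝕜 K = ContinuousLinearMap.id 𝕜 (K × 𝕜) := by
  ext p <;> simp

theorem comp_flipSecond_comp_flipSecond (A : K × 𝕜 →L[𝕜] X) :
    (A ∘L flipSecond 𝕜 K) ∘L flipSecond 𝕜 K = A := by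
  rw [ContinuousLinearMap.comp_assoc, flipSecond_comp_flipSecond, ContinuousLinearMap.comp_id]

theorem extendByVector_comp_flipSecond (S : K →L[𝕜] X) (x : X) :
    extendByVector S x ∘L flipSecond 𝕜 K = extendByVector S (-x) := by
  ext p <;> simp

/-- `A` is homotopic to `B` up to the reflection `(k, a) ↦ (k, -a)`. -/
def HomotopicUpToFlip (A B : K × 𝕜 →L[𝕜] X) : Prop :=
  HomotopicInEmb A B ∨ HomotopicInEmb A (B ∘L flipSecond 𝕜 K)

theorem HomotopicUpToFlip.symm {A B : K × 𝕜 →L[𝕜] X} (h : HomotopicUpToFlip A B) :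
    HomotopicUpToFlip B A := by
  rcases h with h | h
  · exact Or.inl (JoinedIn.symm h)
  · right
    have := h.symm.comp_right isIntoIsomorphism_flipSecond
    rwa [comp_flipSecond_comp_flipSecond] at this

theorem HomotopicUpToFlip.trans {A B C : K × 𝕜 →L[𝕜] X} (h : HomotopicUpToFlip A B)
    (h' : HomotopicUpToFlip B C) : HomotopicUpToFlip A C := by
  rcases h with h | h <;> rcases h' with h' | h'
  · exact Or.inl (JoinedIn.trans h h')
  · exact Or.inr (JoinedIn.trans h h')
  · exact Or.inr (HomotopicInEmb.trans h (h'.comp_right isIntoIsomorphism_flipSecond))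
  · left
    have := h'.comp_right (J := flipSecond 𝕜 K) isIntoIsomorphism_flipSecond
    rw [comp_flipSecond_comp_flipSecond] at this
    exact JoinedIn.trans h this

theorem homotopicUpToFlip_of_comp_inl_eq [CompleteSpace K] {A B : K × 𝕜 →L[𝕜] X}
    (hA : IsIntoIsomorphism A) (hB : IsIntoIsomorphism B)
    (h : A ∘L ContinuousLinearMap.inl 𝕜 K 𝕜 = B ∘L ContinuousLinearMap.inl 𝕜 K 𝕜) :
    HomotopicUpToFlip A B := by
  have hxA := hA.apply_notMem_range_comp_inl
  have hxB := hB.apply_notMem_range_comp_inl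
  have := homotopicInEmb_extendByVector_or_neg (hA.comp isIntoIsomorphism_inl) hxA (h ▸ hxB)
  rw [← extendByVector_comp_flipSecond, extendByVector_comp_inl_apply, h,
    extendByVector_comp_inl_apply] at this
  exact this

/-- A connectedness argument replaces a continuous choice of the added vector along the path. Having
an extension in the class of `A` up to flip is both an open and a closed condition on into
isomorphisms `S`, because any two extensions of the same `S` agree up to flip. -/
theorem homotopicUpToFlip_of_homotopicInEmb_comp_inl [CompleteSpace K] [CompleteSpace X]
    {A B : K × 𝕜 →L[𝕜] X}
    (hA : IsIntoIsomorphism A) (hB : IsIntoIsomorphism B)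
    (h : HomotopicInEmb (A ∘L ContinuousLinearMap.inl 𝕜 K 𝕜)
      (B ∘L ContinuousLinearMap.inl 𝕜 K 𝕜)) :
    HomotopicUpToFlip A B := by
  set U : Set (K →L[𝕜] X) := {S | ∃ A' : K × 𝕜 →L[𝕜] X, IsIntoIsomorphism A' ∧
    A' ∘L ContinuousLinearMap.inl 𝕜 K 𝕜 = S ∧ HomotopicUpToFlip A A'} with hU
  set V : Set (K →L[𝕜] X) := Emb 𝕜 K X \ U with hV
  -- The vector that extends one operator also extends all nearby operators, without leaving the
  -- homotopy class.
  have near : ∀ A' : K × 𝕜 →L[𝕜] X, IsIntoIsomorphism A' →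
      ∀ᶠ S in 𝓝 (A' ∘L ContinuousLinearMap.inl 𝕜 K 𝕜),
        HomotopicInEmb A' (extendByVector S (A' (0, 1))) := by
    intro A' hA'
    have hc := (continuous_extendByVector_left (𝕜 := 𝕜) (K := K) (A' (0, 1))).tendsto
      (A' ∘L ContinuousLinearMap.inl 𝕜 K 𝕜)
    rw [extendByVector_comp_inl_apply] at hc
    exact hc.eventually hA'.eventually_homotopicInEmb
  have hUo : IsOpen U := by
    refine isOpen_iff_mem_nhds.2 ?_
    rintro _ ⟨A', hA', rfl, hAA'⟩
    filter_upwards [near A' hA'] with S hS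
    exact ⟨_, hS.target_mem, by simp, hAA'.trans (Or.inl hS)⟩
  have hVo : IsOpen V := by
    refine isOpen_iff_mem_nhds.2 ?_
    rintro S ⟨hS, hSU⟩
    refine inter_mem (isOpen_emb.mem_nhds hS) ?_
    -- If `S` is onto, all nearby operators are isomorphisms, and these have no into-isomorphic
    -- extension to `K × 𝕜`.
    by_cases hsurj : Function.Surjective S
    · let e := ContinuousLinearEquiv.ofBijective S (LinearMap.ker_eq_bot.2 hS.injective)
        (LinearMap.range_eq_top.2 hsurj)
      have he : (e : K →L[𝕜] X) = S := ContinuousLinearEquiv.coe_ofBijective _ _ _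
      have hev := ContinuousLinearEquiv.nhds e
      rw [he] at hev
      filter_upwards [hev]
      rintro _ ⟨e', rfl⟩ ⟨A', hA', hAS, -⟩
      refine hA'.apply_notMem_range_comp_inl ?_
      rw [hAS]
      exact e'.surjective _
    -- If `S` is not onto, extend `S` and a nearby `S'` by the same `x`. An extension of `S'` in the
    -- class of `A` agrees up to flip with this one, which would put `S` itself in `U`.
    · obtain ⟨x, hx⟩ : ∃ x, x ∉ range S := by
        by_contra hcon
        push Not at hcon
        exact hsurj hcon
      have hBe := isIntoIsomorphism_extendByVector hS hx
      have hev := near _ hBe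
      rw [extendByVector_comp_inl] at hev
      filter_upwards [hev] with S' hS'
      rintro ⟨A', hA', hAS, hAA'⟩
      refine hSU ⟨_, hBe, by simp, hAA'.trans ?_⟩
      have := homotopicUpToFlip_of_comp_inl_eq hA' hS'.target_mem (by rw [hAS]; simp)
      exact this.trans (Or.inl hS'.symm)
  have hmem : ∀ t, h.somePath t ∈ U := by
    have hpre : IsPreconnected (range h.somePath) := isPreconnected_range h.somePath.continuous
    have hsub : range h.somePath ⊆ U := by
      refine hpre.subset_left_of_subset_union hUo hVo disjoint_sdiff_right ?_ ?_
      · rintro _ ⟨t, rfl⟩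
        by_cases hm : h.somePath t ∈ U
        · exact Or.inl hm
        · exact Or.inr ⟨h.somePath_mem t, hm⟩
      · exact ⟨_, ⟨0, rfl⟩, A, hA, by simp, Or.inl (JoinedIn.refl hA)⟩
    exact fun t => hsub ⟨t, rfl⟩
  obtain ⟨A', hA', he, hAA'⟩ := hmem 1
  rw [h.somePath.target] at he
  exact hAA'.trans (homotopicUpToFlip_of_comp_inl_eq hA' hB he)

end OneDimensionalExtension

/-! ### When the sign of the added vector can be reversed. -/

section Flip

variable {𝕜 : Type*} [RCLike 𝕜]
variable {K X : Type*} [NormedAddCommGroup K] [NormedSpace 𝕜 K]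
  [NormedAddCommGroup X] [NormedSpace 𝕜 X]

theorem homotopicInEmb_extendByVector_smul [CompleteSpace K] {S : K →L[𝕜] X}
    (hS : IsIntoIsomorphism S) {x : X} (hx : x ∉ range S) (c : 𝕜)
    (hc : ∀ t ∈ Icc (0 : ℝ) 1, ((1 - t : ℝ) : 𝕜) + (t : 𝕜) * c ≠ 0) :
    HomotopicInEmb (extendByVector S x) (extendByVector S (c • x)) := by
  refine homotopicInEmb_extendByVector_of_segment hS fun t ht hmem => ?_
  have hmem' : ((1 - t : ℝ) : 𝕜) • x + (t : 𝕜) • c • x ∈ S.range := by simpa using hmem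
  have hx' : x ∉ S.range := by simpa using hx
  rw [smul_smul, ← add_smul] at hmem'
  exact hx' ((S.range.smul_mem_iff (hc t ht)).1 hmem')

/-- The vector moves from `x` to `i x` and then to `-x`; the factor `(1 - t) + t i` never vanishes.
-/
theorem homotopicInEmb_extendByVector_neg_of_complex [CompleteSpace K]
    (hI : RCLike.im (RCLike.I : 𝕜) = 1) {S : K →L[𝕜] X}
    (hS : IsIntoIsomorphism S) {x : X} (hx : x ∉ range S) :
    HomotopicInEmb (extendByVector S x) (extendByVector S (-x)) := by
  have hI0 : (RCLike.I : 𝕜) ≠ 0 := by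
    intro h
    simp [h] at hI
  have hc : ∀ t ∈ Icc (0 : ℝ) 1, ((1 - t : ℝ) : 𝕜) + (t : 𝕜) * RCLike.I ≠ 0 := by
    intro t ht h
    have h1 := congrArg RCLike.re h
    have h2 := congrArg RCLike.im h
    simp [hI] at h1 h2
    linarith
  have h1 := homotopicInEmb_extendByVector_smul hS hx _ hc
  have hx' : (RCLike.I : 𝕜) • x ∉ range S := by
    have hx' : x ∉ S.range := by simpa using hx
    intro h
    have h' : (RCLike.I : 𝕜) • x ∈ S.range := by simpa using h
    exact hx' ((S.range.smul_mem_iff hI0).1 h')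
  have h2 := homotopicInEmb_extendByVector_smul hS hx' _ hc
  rw [smul_smul, RCLike.I_mul_I_of_nonzero hI0, neg_one_smul] at h2
  exact h1.trans h2

/-- Past `t = 0` the segment from `x` to `z` lies outside `range A`, hence outside `range S`.
Applied to both `x` and `-x`, this joins them through `z`. -/
theorem homotopicInEmb_extendByVector_of_notMem_range [CompleteSpace K] {A : K × 𝕜 →L[𝕜] X}
    {S : K →L[𝕜] X} (hS : IsIntoIsomorphism S)
    (hAS : A ∘L ContinuousLinearMap.inl 𝕜 K 𝕜 = S) {x z : X}
    (hx : x ∉ range S) (hxA : x ∈ range A) (hz : z ∉ range A) :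
    HomotopicInEmb (extendByVector S x) (extendByVector S z) := by
  refine homotopicInEmb_extendByVector_of_segment hS fun t ht hmem => ?_
  have hle : S.range ≤ A.range := by
    rw [← hAS]
    rintro _ ⟨k, rfl⟩
    exact ⟨(k, 0), rfl⟩
  have hmem' : ((1 - t : ℝ) : 𝕜) • x + (t : 𝕜) • z ∈ S.range := by simpa using hmem
  have hxA' : x ∈ A.range := by simpa using hxA
  have hz' : z ∉ A.range := by simpa using hz
  by_cases h0 : t = 0
  · subst h0
    exact hx (by simpa using hmem)
  · apply hz'
    have := (Submodule.add_mem_iff_right _ (A.range.smul_mem ((1 - t : ℝ) : 𝕜) hxA')).1 (hle hmem')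
    exact (A.range.smul_mem_iff (by exact_mod_cast h0)).1 this

theorem homotopicInEmb_comp_flipSecond [CompleteSpace K] {A : K × 𝕜 →L[𝕜] X}
    (hA : IsIntoIsomorphism A)
    (h : RCLike.im (RCLike.I : 𝕜) = 1 ∨ ¬ Function.Surjective A) :
    HomotopicInEmb A (A ∘L flipSecond 𝕜 K) := by
  have hS := hA.comp (isIntoIsomorphism_inl (𝕜 := 𝕜) (K := K))
  have hx := hA.apply_notMem_range_comp_inl
  suffices HomotopicInEmb (extendByVector (A ∘L ContinuousLinearMap.inl 𝕜 K 𝕜) (A (0, 1)))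
      (extendByVector (A ∘L ContinuousLinearMap.inl 𝕜 K 𝕜) (-A (0, 1))) by
    rwa [← extendByVector_comp_flipSecond, extendByVector_comp_inl_apply] at this
  rcases h with h | h
  · exact homotopicInEmb_extendByVector_neg_of_complex h hS hx
  · obtain ⟨z, hz⟩ : ∃ z, z ∉ range A := by
      by_contra hcon
      push Not at hcon
      exact h hcon
    have h1 := homotopicInEmb_extendByVector_of_notMem_range hS rfl hx ⟨_, rfl⟩ hz
    have h2 := homotopicInEmb_extendByVector_of_notMem_range hS rfl (x := -A (0, 1)) ?_
      ⟨(0, -1), by rw [← map_neg]; simp⟩ hz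
    · exact h1.trans h2.symm
    · rintro ⟨k, hk⟩
      exact hx ⟨-k, by rw [map_neg, hk, neg_neg]⟩

end Flip

/-! ### Reflections and their homotopies. -/

section Reflection

variable {𝕜 : Type*} [RCLike 𝕜]
variable {E X : Type*} [NormedAddCommGroup E] [NormedSpace 𝕜 E]
  [NormedAddCommGroup X] [NormedSpace 𝕜 X]

/-- The operator `y ↦ y - 2 φ(y) x`, a reflection if `φ x = 1`. -/
noncomputable def reflectionAlong (φ : E →L[𝕜] 𝕜) (x : E) : E →L[𝕜] E :=
  ContinuousLinearMap.id 𝕜 E - (2 : 𝕜) • ContinuousLinearMap.smulRightL 𝕜 E E φ x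

@[simp]
theorem reflectionAlong_apply (φ : E →L[𝕜] 𝕜) (x y : E) :
    reflectionAlong φ x y = y - (2 : 𝕜) • φ y • x := by
  simp [reflectionAlong]

theorem reflectionAlong_comp_self {φ : E →L[𝕜] 𝕜} {x : E} (h : φ x = 1) :
    reflectionAlong φ x ∘L reflectionAlong φ x = ContinuousLinearMap.id 𝕜 E := by
  ext y
  simp only [ContinuousLinearMap.comp_apply, reflectionAlong_apply, map_sub, map_smul, h,
    ContinuousLinearMap.id_apply]
  module

theorem isIntoIsomorphism_reflectionAlong {φ : E →L[𝕜] 𝕜} {x : E} (h : φ x = 1) :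
    IsIntoIsomorphism (reflectionAlong φ x) := by
  refine isIntoIsomorphism_of_norm_le ‖reflectionAlong φ x‖ fun y => ?_
  have h1 := (reflectionAlong φ x).le_opNorm (reflectionAlong φ x y)
  rwa [← ContinuousLinearMap.comp_apply, reflectionAlong_comp_self h] at h1

theorem isReflectionOperator_reflectionAlong {φ : E →L[𝕜] 𝕜} {x : E} (h : φ x = 1) :
    IsReflectionOperator (reflectionAlong φ x) := by
  refine ⟨φ.ker, x, ?_, ?_, ?_, ?_⟩
  · have hs : Function.Surjective (φ : E →ₗ[𝕜] 𝕜) := fun a => ⟨a • x, by simp [h]⟩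
    rw [((φ : E →ₗ[𝕜] 𝕜).quotKerEquivOfSurjective hs).finrank_eq, Module.finrank_self]
  · rintro rfl
    simp at h
  · intro y hy
    have hy' : φ y = 0 := hy
    simp [hy']
  · rw [reflectionAlong_apply, h]
    module

theorem IsReflectionOperator.exists_eq_reflectionAlong {R : E →L[𝕜] E}
    (hR : IsReflectionOperator R) : ∃ (φ : E →L[𝕜] 𝕜) (x : E), φ x = 1 ∧ R = reflectionAlong φ x := by
  obtain ⟨H, x, hH, hx, hRH, hRx⟩ := hR
  obtain ⟨g, hg⟩ := SeparatingDual.exists_eq_one (R := 𝕜) hx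
  have hxH : x ∉ H := fun h => by
    have h1 := (hRH x h).symm.trans hRx
    have h2 : (2 : 𝕜) • x = 0 := by
      rw [two_smul]
      nth_rewrite 1 [h1]
      simp
    exact hx ((smul_eq_zero.1 h2).resolve_left two_ne_zero)
  have hdec : ∀ y, ∃ (h : E) (a : 𝕜), h ∈ H ∧ y = h + a • x := by
    intro y
    have hne : H.mkQ x ≠ 0 := by simpa using hxH
    obtain ⟨a, ha⟩ := (finrank_eq_one_iff_of_nonzero' _ hne).1 hH (H.mkQ y)
    refine ⟨y - a • x, a, ?_, by simp⟩
    rw [← Submodule.Quotient.mk_eq_zero]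
    have : H.mkQ (y - a • x) = 0 := by rw [map_sub, map_smul, ha, sub_self]
    exact this
  -- The operator `1 - R` vanishes on `H` and sends `x` to `2x`, so this functional has kernel `H`
  -- and value `1` at `x`. Boundedness comes from that of `R`.
  refine ⟨(2 : 𝕜)⁻¹ • (g ∘L (ContinuousLinearMap.id 𝕜 E - R)), x, ?_, ?_⟩
  · simp [hRx, hg]
    norm_num
  · ext y
    obtain ⟨h, a, hh, rfl⟩ := hdec y
    have e : h + a • x - (R h + a • R x) = (2 * a) • x := by
      rw [hRx, hRH h hh]
      module
    simp only [reflectionAlong_apply, map_add, map_smul, _root_.smul_apply,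
      ContinuousLinearMap.comp_apply, _root_.sub_apply, ContinuousLinearMap.id_apply]
    rw [hRH h hh, hRx]
    simp [hg]
    module

/-- Functional and vector are interpolated simultaneously; since all four pairings are `1`, so is
the pairing along the way. -/
theorem homotopicInEmb_reflectionAlong_of_line {φ ψ : E →L[𝕜] 𝕜} {x y : E} (hφx : φ x = 1)
    (hφy : φ y = 1) (hψx : ψ x = 1) (hψy : ψ y = 1) :
    HomotopicInEmb (reflectionAlong φ x) (reflectionAlong ψ y) := by
  refine homotopicInEmb_of_line (fun t : ℝ =>
    reflectionAlong (((1 - t : ℝ) : 𝕜) • φ + (t : 𝕜) • ψ) (((1 - t : ℝ) : 𝕜) • x + (t : 𝕜) • y))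
    ?_ (by ext; simp) (by ext; simp) fun t ht => isIntoIsomorphism_reflectionAlong ?_
  · unfold reflectionAlong
    fun_prop
  · simp [hφx, hφy, hψx, hψy]

theorem homotopicInEmb_reflectionAlong {φ ψ : E →L[𝕜] 𝕜} {x y : E} (hφ : φ x = 1)
    (hψ : ψ y = 1) : HomotopicInEmb (reflectionAlong φ x) (reflectionAlong ψ y) := by
  -- Such a `k` corrects `x` to a vector `z` with `φ z = ψ z = 1`: move `x` to `z`, then `φ` to `ψ`,
  -- then `z` to `y`. Otherwise `ψ` is a multiple of `φ`, and only the vector has to move.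
  by_cases h : ∃ k, φ k = 0 ∧ ψ k ≠ 0
  · obtain ⟨k, hk, hk'⟩ := h
    have h1 : φ (x + ((1 - ψ x) / ψ k) • k) = 1 := by simp [hφ, hk]
    have h2 : ψ (x + ((1 - ψ x) / ψ k) • k) = 1 := by simp [hk']
    exact (homotopicInEmb_reflectionAlong_of_line hφ h1 hφ h1).trans
      ((homotopicInEmb_reflectionAlong_of_line h1 h1 h2 h2).trans
        (homotopicInEmb_reflectionAlong_of_line h2 hψ h2 hψ))
  · push Not at h
    have hc : ∀ z, ψ z = ψ x * φ z := by
      intro z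
      have h1 := h (z - φ z • x) (by simp [hφ])
      rw [map_sub, map_smul, sub_eq_zero, smul_eq_mul] at h1
      rw [h1, mul_comm]
    have e : reflectionAlong ψ y = reflectionAlong φ (ψ x • y) := by
      ext z
      rw [reflectionAlong_apply, reflectionAlong_apply, hc z]
      module
    have h1 : φ (ψ x • y) = 1 := by rw [map_smul, smul_eq_mul, ← hc, hψ]
    rw [e]
    exact homotopicInEmb_reflectionAlong_of_line hφ h1 hφ h1

theorem IsReflectionOperator.homotopicInEmb {R R' : E →L[𝕜] E} (hR : IsReflectionOperator R)
    (hR' : IsReflectionOperator R') : HomotopicInEmb R R' := by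
  obtain ⟨φ, x, h, rfl⟩ := hR.exists_eq_reflectionAlong
  obtain ⟨ψ, y, h', rfl⟩ := hR'.exists_eq_reflectionAlong
  exact homotopicInEmb_reflectionAlong h h'

theorem IsReflectionOperator.isIntoIsomorphism {R : E →L[𝕜] E} (hR : IsReflectionOperator R) :
    IsIntoIsomorphism R := by
  obtain ⟨φ, x, h, rfl⟩ := hR.exists_eq_reflectionAlong
  exact isIntoIsomorphism_reflectionAlong h

theorem IsReflectionOperator.comp_self {R : E →L[𝕜] E} (hR : IsReflectionOperator R) :
    R ∘L R = ContinuousLinearMap.id 𝕜 E := by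
  obtain ⟨φ, x, h, rfl⟩ := hR.exists_eq_reflectionAlong
  exact reflectionAlong_comp_self h

/-- The splitting `y = (y - f(y) e) + f(y) e`, with continuity of the inverse from the open mapping
theorem. It transports the results on `K × 𝕜` to a space with a chosen hyperplane. -/
theorem exists_equiv_prod {K : Type*} [NormedAddCommGroup K] [NormedSpace 𝕜 K] [CompleteSpace K]
    [CompleteSpace E] {j : K →L[𝕜] E} (hj : Function.Injective j) {f : E →L[𝕜] 𝕜} {e : E}
    (hfe : f e = 1) (hf : ∀ y, f y = 0 ↔ y ∈ range j) :
    ∃ Φ : (K × 𝕜) ≃L[𝕜] E, (Φ : K × 𝕜 →L[𝕜] E) = extendByVector j e := by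
  have hfj : ∀ k, f (j k) = 0 := fun k => (hf _).2 ⟨k, rfl⟩
  have hinj : Function.Injective (extendByVector j e) := by
    refine (injective_iff_map_eq_zero _).2 ?_
    rintro ⟨k, a⟩ h
    rw [extendByVector_apply] at h
    have h1 := congrArg f h
    simp [hfj, hfe] at h1
    subst h1
    simp only [zero_smul, add_zero] at h
    rw [hj (h.trans (map_zero j).symm)]
    rfl
  have hsurj : Function.Surjective (extendByVector j e) := by
    intro y
    obtain ⟨k, hk⟩ := (hf (y - f y • e)).1 (by simp [hfe])
    exact ⟨(k, f y), by simp [hk]⟩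
  exact ⟨ContinuousLinearEquiv.ofBijective _ (LinearMap.ker_eq_bot.2 hinj)
    (LinearMap.range_eq_top.2 hsurj), ContinuousLinearEquiv.coe_ofBijective _ _ _⟩

theorem comp_equiv_comp_symm {K : Type*} [NormedAddCommGroup K] [NormedSpace 𝕜 K]
    (A : E →L[𝕜] X) (Φ : K ≃L[𝕜] E) :
    (A ∘L (Φ : K →L[𝕜] E)) ∘L (Φ.symm : E →L[𝕜] K) = A := by
  ext
  simp

theorem HomotopicInEmb.of_comp_equiv {K : Type*} [NormedAddCommGroup K] [NormedSpace 𝕜 K]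
    {A B : E →L[𝕜] X} {Φ : K ≃L[𝕜] E}
    (h : HomotopicInEmb (A ∘L (Φ : K →L[𝕜] E)) (B ∘L (Φ : K →L[𝕜] E))) : HomotopicInEmb A B := by
  have := h.comp_right Φ.symm.isIntoIsomorphism
  rwa [comp_equiv_comp_symm, comp_equiv_comp_symm] at this

theorem reflectionAlong_comp_extendByVector {K : Type*} [NormedAddCommGroup K] [NormedSpace 𝕜 K]
    {j : K →L[𝕜] E} {f : E →L[𝕜] 𝕜} {e : E} (hfe : f e = 1) (hf : ∀ k, f (j k) = 0) :
    reflectionAlong f e ∘L extendByVector j e = extendByVector j e ∘L flipSecond 𝕜 K := by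
  ext p
  · simp [hf]
  · simp [hfe]
    module

/-- In the coordinates `φ.ker × 𝕜` the reflection is `flipSecond`, so this is
`homotopicInEmb_comp_flipSecond`. -/
theorem IsReflectionOperator.homotopicInEmb_comp [CompleteSpace E] {R : E →L[𝕜] E}
    (hR : IsReflectionOperator R) {B : E →L[𝕜] X} (hB : IsIntoIsomorphism B)
    (h : RCLike.im (RCLike.I : 𝕜) = 1 ∨ ¬ Function.Surjective B) :
    HomotopicInEmb (B ∘L R) B := by
  obtain ⟨φ, x, hφ, rfl⟩ := hR.exists_eq_reflectionAlong
  have : CompleteSpace φ.ker := φ.isClosed_ker.completeSpace_coe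
  obtain ⟨Φ, hΦ⟩ := exists_equiv_prod (j := φ.ker.subtypeL) Subtype.val_injective hφ
    (by intro y; simp)
  refine HomotopicInEmb.of_comp_equiv (Φ := Φ) ?_
  have h1 : (B ∘L reflectionAlong φ x) ∘L (Φ : φ.ker × 𝕜 →L[𝕜] E) =
      (B ∘L (Φ : φ.ker × 𝕜 →L[𝕜] E)) ∘L flipSecond 𝕜 _ := by
    rw [ContinuousLinearMap.comp_assoc, ContinuousLinearMap.comp_assoc, hΦ,
      reflectionAlong_comp_extendByVector hφ (fun k => k.2)]
  rw [h1]
  refine (homotopicInEmb_comp_flipSecond (hB.comp Φ.isIntoIsomorphism) (h.imp_right ?_)).symm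
  intro hns hs
  exact hns (Function.Surjective.of_comp hs)

end Reflection

/-! ### From a subspace of finite codimension to the whole space. -/

section CommonKernel

variable {𝕜 : Type*} [RCLike 𝕜]
variable {Y X : Type*} [NormedAddCommGroup Y] [NormedSpace 𝕜 Y]
  [NormedAddCommGroup X] [NormedSpace 𝕜 X]

/-- The common kernel of a finite set of functionals. -/
def commonKernel (s : Finset (Y →L[𝕜] 𝕜)) : Submodule 𝕜 Y :=
  ⨅ f ∈ s, f.ker

@[simp]
theorem mem_commonKernel {s : Finset (Y →L[𝕜] 𝕜)} {y : Y} :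
    y ∈ commonKernel s ↔ ∀ f ∈ s, f y = 0 := by
  simp [commonKernel]

theorem isClosed_commonKernel (s : Finset (Y →L[𝕜] 𝕜)) : IsClosed (commonKernel s : Set Y) := by
  have : (commonKernel s : Set Y) = ⋂ f ∈ s, {y | f y = 0} := by
    ext y
    simp
  rw [this]
  exact isClosed_biInter fun f _ => isClosed_eq f.continuous continuous_const

/-- The possible flip on `W ≅ W' × 𝕜` is the restriction of a reflection of all of `Y`, because `e`
lies in `W`. The correction is thus again a global operator, which allows iteration. -/
theorem homotopicInEmb_restrict_or_reflection [CompleteSpace Y] [CompleteSpace X]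
    {A B : Y →L[𝕜] X} (hA : IsIntoIsomorphism A) (hB : IsIntoIsomorphism B)
    {W W' : Submodule 𝕜 Y} (hW : IsClosed (W : Set Y)) (hW' : IsClosed (W' : Set Y))
    {f : Y →L[𝕜] 𝕜} {e : Y} (heW : e ∈ W) (hfe : f e = 1) (hWW' : ∀ y, y ∈ W' ↔ y ∈ W ∧ f y = 0)
    (h : HomotopicInEmb (A ∘L W'.subtypeL) (B ∘L W'.subtypeL)) :
    HomotopicInEmb (A ∘L W.subtypeL) (B ∘L W.subtypeL) ∨
      HomotopicInEmb (A ∘L W.subtypeL) ((B ∘L reflectionAlong f e) ∘L W.subtypeL) := by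
  have : CompleteSpace W := hW.completeSpace_coe
  have : CompleteSpace W' := hW'.completeSpace_coe
  let j : W' →L[𝕜] W := W'.subtypeL.codRestrict W fun y => ((hWW' y).1 y.2).1
  have hj : ∀ y : W', ((j y : W) : Y) = y := fun y => rfl
  obtain ⟨Φ, hΦ⟩ := exists_equiv_prod (j := j) (f := f ∘L W.subtypeL) (e := ⟨e, heW⟩)
    (fun y z hyz => Subtype.ext (congrArg (fun w : W => (w : Y)) hyz)) hfe (by
      rintro ⟨y, hy⟩
      constructor
      · intro h0
        exact ⟨⟨y, (hWW' y).2 ⟨hy, h0⟩⟩, rfl⟩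
      · rintro ⟨z, hz⟩
        rw [← hz]
        exact ((hWW' z).1 z.2).2)
  have hinl : ∀ C : Y →L[𝕜] X, ((C ∘L W.subtypeL) ∘L (Φ : W' × 𝕜 →L[𝕜] W)) ∘L
      ContinuousLinearMap.inl 𝕜 W' 𝕜 = C ∘L W'.subtypeL := by
    intro C
    rw [hΦ]
    ext y
    simp [hj]
  have hflip : ((B ∘L W.subtypeL) ∘L (Φ : W' × 𝕜 →L[𝕜] W)) ∘L flipSecond 𝕜 W' =
      ((B ∘L reflectionAlong f e) ∘L W.subtypeL) ∘L (Φ : W' × 𝕜 →L[𝕜] W) := by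
    rw [hΦ]
    ext p
    · have : f p = 0 := ((hWW' p).1 p.2).2
      simp [hj, this]
    · simp [hfe]
      module
  have key := homotopicUpToFlip_of_homotopicInEmb_comp_inl
    ((hA.comp (isIntoIsomorphism_subtypeL W)).comp Φ.isIntoIsomorphism)
    ((hB.comp (isIntoIsomorphism_subtypeL W)).comp Φ.isIntoIsomorphism)
    (by rw [hinl, hinl]; exact h)
  unfold HomotopicUpToFlip at key
  rw [hflip] at key
  exact key.imp HomotopicInEmb.of_comp_equiv HomotopicInEmb.of_comp_equiv

theorem homotopicInEmb_or_reflection_of_restrict [CompleteSpace Y] [CompleteSpace X]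
    {A : Y →L[𝕜] X} (hA : IsIntoIsomorphism A) (s : Finset (Y →L[𝕜] 𝕜)) :
    ∀ B : Y →L[𝕜] X, IsIntoIsomorphism B →
      HomotopicInEmb (A ∘L (commonKernel s).subtypeL) (B ∘L (commonKernel s).subtypeL) →
      HomotopicInEmb A B ∨
        ∃ R : Y →L[𝕜] Y, IsReflectionOperator R ∧ HomotopicInEmb A (B ∘L R) := by
  classical
  -- `B` stays quantified in the induction, since a step may replace it by its composition with a
  -- reflection.
  induction s using Finset.induction_on with
  | empty =>
    intro B hB h
    left
    have hJ : ∀ y : Y, y ∈ commonKernel (∅ : Finset (Y →L[𝕜] 𝕜)) := by simp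
    have := h.comp_right (J := (ContinuousLinearMap.id 𝕜 Y).codRestrict _ hJ)
      ⟨1, one_pos, fun y => (one_mul _).le⟩
    exact this
  | insert f s _ ih =>
    intro B hB h
    by_cases hf : ∀ y ∈ commonKernel s, f y = 0
    · have e : commonKernel (insert f s) = commonKernel s := by
        ext y
        rw [mem_commonKernel, Finset.forall_mem_insert, ← mem_commonKernel]
        exact ⟨fun h => h.2, fun h => ⟨hf y h, h⟩⟩
      rw [e] at h
      exact ih B hB h
    · push Not at hf
      obtain ⟨y, hy, hfy⟩ := hf
      have hfe : f ((f y)⁻¹ • y) = 1 := by simp [hfy]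
      rcases homotopicInEmb_restrict_or_reflection hA hB (isClosed_commonKernel s)
        (isClosed_commonKernel (insert f s)) (Submodule.smul_mem _ (f y)⁻¹ hy) hfe (by
          intro z
          rw [mem_commonKernel, Finset.forall_mem_insert, ← mem_commonKernel, and_comm]) h
        with h1 | h1
      · exact ih B hB h1
      · have hR := isReflectionOperator_reflectionAlong hfe
        rcases ih _ (hB.comp hR.isIntoIsomorphism) h1 with h2 | ⟨R', hR', h2⟩
        · exact Or.inr ⟨_, hR, h2⟩
        -- Two reflections have accumulated. The second is homotopic to the first, and the first
        -- squares to the identity, so they cancel.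
        · left
          refine h2.trans ?_
          have h3 := (hR'.homotopicInEmb hR).comp_left (hB.comp hR.isIntoIsomorphism)
          have h4 : (B ∘L reflectionAlong f ((f y)⁻¹ • y)) ∘L reflectionAlong f ((f y)⁻¹ • y) = B := by
            rw [ContinuousLinearMap.comp_assoc, hR.comp_self, ContinuousLinearMap.comp_id]
          rwa [h4] at h3

end CommonKernel

/-! ### Triangular systems of vectors and functionals. -/

section TriangularSystem

variable {𝕜 : Type*} [RCLike 𝕜]
variable {Y X : Type*} [NormedAddCommGroup Y] [NormedSpace 𝕜 Y]
  [NormedAddCommGroup X] [NormedSpace 𝕜 X]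

/-- The remainder after subtracting successively the multiples of `y 0, …, y (n - 1)` prescribed by
the functionals `f 0, …, f (n - 1)`. -/
noncomputable def triangularRemainder (y : ℕ → Y) (f : ℕ → Y →L[𝕜] 𝕜) : ℕ → Y →L[𝕜] Y
  | 0 => ContinuousLinearMap.id 𝕜 Y
  | n + 1 => triangularRemainder y f n - (f n ∘L triangularRemainder y f n).smulRight (y n)

theorem triangularRemainder_succ_apply (y : ℕ → Y) (f : ℕ → Y →L[𝕜] 𝕜) (n : ℕ) (v : Y) :
    triangularRemainder y f (n + 1) v =
      triangularRemainder y f n v - f n (triangularRemainder y f n v) • y n := by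
  simp [triangularRemainder]

variable {y : ℕ → Y} {f : ℕ → Y →L[𝕜] 𝕜}

theorem triangularRemainder_apply_of_le (hfy0 : ∀ m n, m < n → f m (y n) = 0) {n j : ℕ}
    (h : n ≤ j) : triangularRemainder y f n (y j) = y j := by
  induction n with
  | zero => rfl
  | succ n ih =>
    rw [triangularRemainder_succ_apply, ih (by omega), hfy0 n j (by omega), zero_smul, sub_zero]

theorem triangularRemainder_apply_of_lt (hfy : ∀ n, f n (y n) = 1)
    (hfy0 : ∀ m n, m < n → f m (y n) = 0) {n j : ℕ}
    (h : j < n) : triangularRemainder y f n (y j) = 0 := by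
  induction n with
  | zero => omega
  | succ n ih =>
    rw [triangularRemainder_succ_apply]
    rcases (Nat.lt_succ_iff.1 h).lt_or_eq with h1 | rfl
    · rw [ih h1, map_zero, zero_smul, sub_zero]
    · rw [triangularRemainder_apply_of_le hfy0 le_rfl, hfy, one_smul, sub_self]

theorem norm_triangularRemainder_apply_le (hy : ∀ n, ‖y n‖ = 1) (hf : ∀ n, ‖f n‖ ≤ 1) (n : ℕ)
    (v : Y) : ‖triangularRemainder y f n v‖ ≤ 2 ^ n * ‖v‖ := by
  induction n with
  | zero => simp [triangularRemainder]
  | succ n ih =>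
    rw [triangularRemainder_succ_apply]
    set w := triangularRemainder y f n v
    have h1 : ‖f n w • y n‖ ≤ ‖w‖ := by
      rw [norm_smul, hy, mul_one]
      simpa using (f n).le_of_opNorm_le (hf n) w
    calc ‖w - f n w • y n‖ ≤ ‖w‖ + ‖f n w • y n‖ := norm_sub_le _ _
      _ ≤ 2 ^ (n + 1) * ‖v‖ := by rw [pow_succ]; linarith

theorem linearIndependent_of_triangular (hfy : ∀ n, f n (y n) = 1)
    (hfy0 : ∀ m n, m < n → f m (y n) = 0) : LinearIndependent 𝕜 y := by
  rw [linearIndependent_iff']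
  intro t a h i hi
  have h1 := congrArg (fun v => f i (triangularRemainder y f i v)) h
  simp only [map_sum, map_smul, map_zero] at h1
  rw [Finset.sum_eq_single_of_mem i hi] at h1
  · rwa [triangularRemainder_apply_of_le hfy0 le_rfl, hfy, smul_eq_mul, mul_one] at h1
  · intro j _ hj
    rcases hj.lt_or_gt with h2 | h2
    · rw [triangularRemainder_apply_of_lt hfy hfy0 h2, map_zero, smul_zero]
    · rw [triangularRemainder_apply_of_le hfy0 h2.le, hfy0 i j h2, smul_zero]

/-- A triangular system takes the place of a basic sequence: its coefficients may grow like `2 ^ m`,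
but the decay of `A (y m)` beats this. Step `m` contributes at most `2 ^ m * ‖v‖ * ε * (1 / 4) ^ (m
+ 1)`, and these terms sum to less than `ε * ‖v‖`. -/
theorem norm_apply_le_of_triangular (hy : ∀ n, ‖y n‖ = 1) (hf : ∀ n, ‖f n‖ ≤ 1)
    (hfy : ∀ n, f n (y n) = 1) (hfy0 : ∀ m n, m < n → f m (y n) = 0) {A : Y →L[𝕜] X} {ε : ℝ}
    (hε : 0 ≤ ε) (hA : ∀ n, ‖A (y n)‖ ≤ ε * (1 / 4) ^ (n + 1)) {v : Y}
    (hv : v ∈ (Submodule.span 𝕜 (range y)).topologicalClosure) : ‖A v‖ ≤ ε * ‖v‖ := by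
  have h1 : ∀ v m, ‖A v - A (triangularRemainder y f m v)‖ ≤ ε * ‖v‖ * (1 - (1 / 2) ^ m) := by
    intro v m
    induction m with
    | zero => simp [triangularRemainder]
    | succ m ih =>
      set w := triangularRemainder y f m v with hw
      have e : A v - A (triangularRemainder y f (m + 1) v) = (A v - A w) + f m w • A (y m) := by
        rw [triangularRemainder_succ_apply, map_sub, map_smul]
        abel
      have h2 : ‖f m w‖ ≤ 2 ^ m * ‖v‖ := by
        refine le_trans ?_ (norm_triangularRemainder_apply_le hy hf m v)
        simpa using (f m).le_of_opNorm_le (hf m) w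
      have h3 : ‖f m w • A (y m)‖ ≤ (2 ^ m * ‖v‖) * (ε * (1 / 4) ^ (m + 1)) := by
        rw [norm_smul]
        exact mul_le_mul h2 (hA m) (norm_nonneg _) (by positivity)
      have h4 : (2 ^ m * ‖v‖) * (ε * (1 / 4) ^ (m + 1)) = ε * ‖v‖ * ((1 / 2) ^ m / 4) := by
        have h5 : (2 : ℝ) ^ m * (1 / 4) ^ m = (1 / 2) ^ m := by
          rw [← mul_pow]
          norm_num
        rw [← h5]
        ring
      have h6 : 0 ≤ ε * ‖v‖ * (1 / 2) ^ m := by positivity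
      rw [e]
      refine (norm_add_le _ _).trans ((add_le_add ih (h3.trans h4.le)).trans ?_)
      rw [pow_succ]
      linarith
  -- On the algebraic span the remainder eventually vanishes, so the telescoped estimate bounds `A
  -- v` itself; the closure follows because the inequality is a closed condition.
  have h2 : ∀ v ∈ Submodule.span 𝕜 (range y), ∃ m, ∀ n ≥ m, triangularRemainder y f n v = 0 := by
    intro v hv
    induction hv using Submodule.span_induction with
    | mem v hv =>
      obtain ⟨j, rfl⟩ := hv
      exact ⟨j + 1, fun n hn => triangularRemainder_apply_of_lt hfy hfy0 hn⟩
    | zero => exact ⟨0, fun n _ => map_zero _⟩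
    | add u v _ _ hu hv =>
      obtain ⟨a, ha⟩ := hu
      obtain ⟨b, hb⟩ := hv
      refine ⟨max a b, fun n hn => ?_⟩
      rw [map_add, ha n ((le_max_left _ _).trans hn), hb n ((le_max_right _ _).trans hn), add_zero]
    | smul c v _ hv =>
      obtain ⟨a, ha⟩ := hv
      exact ⟨a, fun n hn => by rw [map_smul, ha n hn, smul_zero]⟩
  have hcl : IsClosed {v : Y | ‖A v‖ ≤ ε * ‖v‖} :=
    isClosed_le A.continuous.norm (continuous_const.mul continuous_norm)
  refine closure_minimal (s := (Submodule.span 𝕜 (range y) : Set Y)) ?_ hcl hv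
  intro v hv
  obtain ⟨m, hm⟩ := h2 v hv
  have h3 := h1 v m
  rw [hm m le_rfl, map_zero, sub_zero] at h3
  refine h3.trans (mul_le_of_le_one_right (by positivity) ?_)
  have : (0 : ℝ) ≤ (1 / 2) ^ m := by positivity
  linarith

end TriangularSystem

/-! ### Upper semi-Fredholm operators on HI spaces. -/

section FredholmAlternative

variable {𝕜 : Type*} [RCLike 𝕜]
variable {Y X : Type*} [NormedAddCommGroup Y] [NormedSpace 𝕜 Y]
  [NormedAddCommGroup X] [NormedSpace 𝕜 X]

/-- An operator is upper semi-Fredholm if it is bounded below on a closed subspace of finite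
codimension, that is, on the common kernel of finitely many functionals. -/
def IsUpperSemiFredholm (A : Y →L[𝕜] X) : Prop :=
  ∃ s : Finset (Y →L[𝕜] 𝕜), IsIntoIsomorphism (A ∘L (commonKernel s).subtypeL)

theorem IsIntoIsomorphism.isUpperSemiFredholm {A : Y →L[𝕜] X} (hA : IsIntoIsomorphism A) :
    IsUpperSemiFredholm A :=
  ⟨∅, hA.comp (isIntoIsomorphism_subtypeL _)⟩

/-- The case `a = 0` is included: the zero operator is bounded below only on the trivial subspace,
where every operator is. -/
theorem IsUpperSemiFredholm.of_smul {A : Y →L[𝕜] X} {a : 𝕜} (h : IsUpperSemiFredholm (a • A)) :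
    IsUpperSemiFredholm A := by
  obtain ⟨s, c, hc, h⟩ := h
  refine ⟨s, isIntoIsomorphism_of_norm_le (c⁻¹ * ‖a‖) fun w => ?_⟩
  have := h w
  rw [mul_assoc, ← norm_smul, ← div_eq_inv_mul, le_div_iff₀ hc, mul_comm]
  exact this

theorem exists_norm_eq_one_of_not_isUpperSemiFredholm {A : Y →L[𝕜] X}
    (hA : ¬ IsUpperSemiFredholm A) (s : Finset (Y →L[𝕜] 𝕜)) {ε : ℝ} (hε : 0 < ε) :
    ∃ y ∈ commonKernel s, ‖y‖ = 1 ∧ ‖A y‖ ≤ ε := by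
  by_contra! hcon
  refine hA ⟨s, ε, hε, fun w => ?_⟩
  by_cases hw : w = 0
  · simp [hw]
  have hw' : ‖(w : Y)‖ ≠ 0 := by simpa using hw
  have h1 := hcon (((‖(w : Y)‖⁻¹ : ℝ) : 𝕜) • (w : Y)) (Submodule.smul_mem _ _ w.2)
    (by rw [norm_smul, RCLike.norm_ofReal, abs_of_nonneg (by positivity), inv_mul_cancel₀ hw'])
  rw [map_smul, norm_smul, RCLike.norm_ofReal, abs_of_nonneg (by positivity),
    ← div_eq_inv_mul, lt_div_iff₀ (lt_of_le_of_ne (norm_nonneg _) hw'.symm)] at h1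
  exact h1.le

/-- Unit vectors with rapidly decreasing images are chosen inductively in the common kernel of `s`
and of norming functionals for the earlier vectors. They form a triangular system, and the closed
span is the required subspace. -/
theorem exists_subspace_of_not_isUpperSemiFredholm {A : Y →L[𝕜] X}
    (hA : ¬ IsUpperSemiFredholm A) (s : Finset (Y →L[𝕜] 𝕜)) {ε : ℝ} (hε : 0 < ε) :
    ∃ V ≤ commonKernel s, IsInfDimClosedSubspace V ∧ ∀ v ∈ V, ‖A v‖ ≤ ε * ‖v‖ := by
  classical
  -- The natural number in each triple is a step counter, kept because the recursion sees only the
  -- finite set of earlier choices. It increases strictly, so it is at least `n` at stage `n`.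
  obtain ⟨p, hp, hr⟩ := exists_seq_of_forall_finset_exists
    (fun p : Y × (Y →L[𝕜] 𝕜) × ℕ => ‖p.1‖ = 1 ∧ ‖p.2.1‖ ≤ 1 ∧ p.2.1 p.1 = 1 ∧
      p.1 ∈ commonKernel s ∧ ‖A p.1‖ ≤ ε * (1 / 4) ^ (p.2.2 + 1))
    (fun p q => p.2.1 q.1 = 0 ∧ p.2.2 < q.2.2) (by
      intro t _
      obtain ⟨y, hy, hy1, hAy⟩ := exists_norm_eq_one_of_not_isUpperSemiFredholm hA
        (s ∪ t.image fun p => p.2.1)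
        (ε := ε * (1 / 4) ^ ((t.sup fun p => p.2.2) + 1 + 1)) (by positivity)
      obtain ⟨g, hg, hgy⟩ := exists_dual_vector 𝕜 y (by rw [hy1]; exact one_ne_zero)
      rw [mem_commonKernel] at hy
      refine ⟨(y, g, (t.sup fun p => p.2.2) + 1), ⟨hy1, hg.le, by simp [hgy, hy1], ?_, hAy⟩, ?_⟩
      · rw [mem_commonKernel]
        exact fun f hf => hy f (Finset.mem_union_left _ hf)
      · intro q hq
        exact ⟨hy _ (Finset.mem_union_right _ (Finset.mem_image_of_mem _ hq)),
          Nat.lt_succ_of_le (Finset.le_sup (f := fun p : Y × (Y →L[𝕜] 𝕜) × ℕ => p.2.2) hq)⟩)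
  have hk : ∀ n, n ≤ (p n).2.2 := fun _ => (strictMono_nat_of_lt_succ fun n =>
    (hr n (n + 1) n.lt_succ_self).2 : StrictMono fun n => (p n).2.2).le_apply
  have hfy : ∀ n, (p n).2.1 (p n).1 = 1 := fun n => (hp n).2.2.1
  have hfy0 : ∀ m n, m < n → (p m).2.1 (p n).1 = 0 := fun m n h => (hr m n h).1
  refine ⟨(Submodule.span 𝕜 (range fun n => (p n).1)).topologicalClosure, ?_,
    ⟨Submodule.isClosed_topologicalClosure _, ?_⟩, ?_⟩
  · refine Submodule.topologicalClosure_minimal _ (Submodule.span_le.2 ?_) (isClosed_commonKernel s)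
    rintro _ ⟨n, rfl⟩
    exact (hp n).2.2.2.1
  · intro hfin
    have hli := linearIndependent_of_triangular hfy hfy0
    refine Module.Finite.not_linearIndependent_of_infinite (R := 𝕜)
      (fun n => (⟨(p n).1, Submodule.le_topologicalClosure _ (Submodule.subset_span ⟨n, rfl⟩)⟩ :
        (Submodule.span 𝕜 (range fun n => (p n).1)).topologicalClosure)) ?_
    exact LinearIndependent.of_comp (Submodule.subtype _) hli
  · intro v hv
    refine norm_apply_le_of_triangular (fun n => (hp n).1) (fun n => (hp n).2.1) hfy hfy0 hε.le
      (fun n => (hp n).2.2.2.2.trans ?_) hv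
    exact mul_le_mul_of_nonneg_left
      (pow_le_pow_of_le_one (by norm_num) (by norm_num) (Nat.succ_le_succ (hk n))) hε.le

theorem not_isUpperSemiFredholm_add (hY : IsHereditarilyIndecomposable 𝕜 Y) {A B : Y →L[𝕜] X}
    (hA : ¬ IsUpperSemiFredholm A) (hB : ¬ IsUpperSemiFredholm B) :
    ¬ IsUpperSemiFredholm (A + B) := by
  rintro ⟨s, c, hc, h⟩
  obtain ⟨U, hUs, hU, hUA⟩ := exists_subspace_of_not_isUpperSemiFredholm hA s (ε := c / 4)
    (by positivity)
  obtain ⟨V, hVs, hV, hVB⟩ := exists_subspace_of_not_isUpperSemiFredholm hB s (ε := c / 4)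
    (by positivity)
  -- If `u + v` is small relative to `M = max ‖u‖ ‖v‖`, then `(A + B) u = A u + B (u + v) - B v` and
  -- `(A + B) v = A (u + v) - A u + B v` both have norm below `c * M`. The lower bound `c` for `A +
  -- B` is then violated at whichever of `u`, `v` has norm `M`.
  refine hY.2 U V hU hV ⟨c / 4 / (‖A‖ + ‖B‖ + 1), by positivity, ?_⟩
  rintro ⟨u, v⟩
  by_contra! hcon
  set M := ‖((u, v) : U × V)‖ with hM
  have hM0 : 0 ≤ M := norm_nonneg _
  have hcon' : ‖(u : Y) + v‖ * (‖A‖ + ‖B‖ + 1) < c / 4 * M := by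
    have : ‖(u : Y) + v‖ < c / 4 / (‖A‖ + ‖B‖ + 1) * M := hcon
    rw [div_mul_eq_mul_div, lt_div_iff₀ (by positivity)] at this
    exact this
  have huM : ‖(u : Y)‖ ≤ M := norm_fst_le ((u, v) : U × V)
  have hvM : ‖(v : Y)‖ ≤ M := norm_snd_le ((u, v) : U × V)
  have hu : c * ‖(u : Y)‖ ≤ ‖A u + B u‖ := h ⟨u, hUs u.2⟩
  have hv : c * ‖(v : Y)‖ ≤ ‖A v + B v‖ := h ⟨v, hVs v.2⟩
  have hAu := hUA u u.2
  have hBv := hVB v v.2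
  have hAuv := A.le_opNorm ((u : Y) + v)
  have hBuv := B.le_opNorm ((u : Y) + v)
  have h1 : ‖A u + B u‖ ≤ ‖A u‖ + ‖B ((u : Y) + v)‖ + ‖B v‖ := by
    have : A u + B u = A u + B ((u : Y) + v) - B v := by rw [map_add]; abel
    rw [this]
    exact (norm_sub_le _ _).trans (add_le_add_left (norm_add_le _ _) _)
  have h2 : ‖A v + B v‖ ≤ ‖A ((u : Y) + v)‖ + ‖A u‖ + ‖B v‖ := by
    have : A v + B v = A ((u : Y) + v) - A u + B v := by rw [map_add]; abel
    rw [this]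
    exact (norm_add_le _ _).trans (add_le_add_left (norm_sub_le _ _) _)
  have h3 : 0 ≤ ‖A‖ * ‖(u : Y) + v‖ := by positivity
  have h4 : 0 ≤ ‖B‖ * ‖(u : Y) + v‖ := by positivity
  have h5 : 0 ≤ ‖(u : Y) + v‖ := norm_nonneg _
  have h6 : c * ‖(u : Y)‖ ≤ c * M := mul_le_mul_of_nonneg_left huM hc.le
  have h7 : c * ‖(v : Y)‖ ≤ c * M := mul_le_mul_of_nonneg_left hvM hc.le
  have h8 : M = ‖(u : Y)‖ ∨ M = ‖(v : Y)‖ := max_choice ‖(u : Y)‖ ‖(v : Y)‖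
  rcases h8 with h8 | h8
  · rw [← h8] at hu
    linarith
  · rw [← h8] at hv
    linarith

/-- A finite set of functionals that works at `t` works near `t`, as into isomorphisms form an open
set. By compactness finitely many such sets cover the segment, and their union works throughout. -/
theorem exists_homotopicInEmb_restrict_of_segment {A B : Y →L[𝕜] X}
    (h : ∀ t ∈ Icc (0 : ℝ) 1, IsUpperSemiFredholm (((1 - t : ℝ) : 𝕜) • A + (t : 𝕜) • B)) :
    ∃ s : Finset (Y →L[𝕜] 𝕜),
      HomotopicInEmb (A ∘L (commonKernel s).subtypeL) (B ∘L (commonKernel s).subtypeL) := by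
  classical
  have hcont : ∀ s : Finset (Y →L[𝕜] 𝕜), Continuous fun t : ℝ =>
      (((1 - t : ℝ) : 𝕜) • A + (t : 𝕜) • B) ∘L (commonKernel s).subtypeL := fun s => by fun_prop
  have hmono : ∀ (s s' : Finset (Y →L[𝕜] 𝕜)) (C : Y →L[𝕜] X), s ⊆ s' →
      IsIntoIsomorphism (C ∘L (commonKernel s).subtypeL) →
      IsIntoIsomorphism (C ∘L (commonKernel s').subtypeL) := by
    rintro s s' C hss ⟨c, hc, hC⟩
    refine ⟨c, hc, fun w => hC ⟨w, ?_⟩⟩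
    have := w.2
    rw [mem_commonKernel] at this ⊢
    exact fun f hf => this f (hss hf)
  obtain ⟨s, hs⟩ : ∃ s : Finset (Y →L[𝕜] 𝕜), ∀ t ∈ Icc (0 : ℝ) 1, IsIntoIsomorphism
      ((((1 - t : ℝ) : 𝕜) • A + (t : 𝕜) • B) ∘L (commonKernel s).subtypeL) := by
    refine isCompact_Icc.induction_on (p := fun K : Set ℝ => ∃ s : Finset (Y →L[𝕜] 𝕜),
      ∀ t ∈ K, IsIntoIsomorphism
        ((((1 - t : ℝ) : 𝕜) • A + (t : 𝕜) • B) ∘L (commonKernel s).subtypeL)) ?_ ?_ ?_ ?_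
    · exact ⟨∅, fun t ht => ht.elim⟩
    · rintro K K' hK ⟨s, hs⟩
      exact ⟨s, fun t ht => hs t (hK ht)⟩
    · rintro K K' ⟨s, hs⟩ ⟨s', hs'⟩
      refine ⟨s ∪ s', ?_⟩
      rintro t (ht | ht)
      · exact hmono _ _ _ Finset.subset_union_left (hs t ht)
      · exact hmono _ _ _ Finset.subset_union_right (hs' t ht)
    · intro t ht
      obtain ⟨s, hs⟩ := h t ht
      exact ⟨_, mem_nhdsWithin_of_mem_nhds
        ((hcont s).continuousAt.preimage_mem_nhds (isOpen_emb.mem_nhds hs)), s, fun u hu => hu⟩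
  exact ⟨s, homotopicInEmb_of_line _ (hcont s) (by simp) (by simp) hs⟩

theorem homotopicInEmb_smul_neg {J : Y →L[𝕜] X} (hJ : IsIntoIsomorphism J) {a : ℝ} (ha : 0 < a) :
    HomotopicInEmb ((-a : 𝕜) • J) (-J) := by
  refine homotopicInEmb_of_line (fun t : ℝ => ((-((1 - t) * a + t) : ℝ) : 𝕜) • J) (by fun_prop)
    (by simp) (by simp) fun t ht => hJ.smul ?_
  have : 0 < (1 - t) * a + t := by
    rcases ht.1.eq_or_lt with rfl | h
    · simpa
    · have := mul_nonneg (sub_nonneg.2 ht.2) ha.le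
      linarith
  exact_mod_cast (neg_neg_of_pos this).ne

theorem IsHereditarilyIndecomposable.exists_homotopicInEmb_restrict
    (hY : IsHereditarilyIndecomposable 𝕜 Y) {J T : Y →L[𝕜] X} (hJ : IsIntoIsomorphism J)
    (hT : IsIntoIsomorphism T) : ∃ B : Y →L[𝕜] X, (HomotopicInEmb B J ∨ HomotopicInEmb B (-J)) ∧
      ∃ s : Finset (Y →L[𝕜] 𝕜),
        HomotopicInEmb (T ∘L (commonKernel s).subtypeL) (B ∘L (commonKernel s).subtypeL) := by
  by_cases h : ∀ t ∈ Icc (0 : ℝ) 1, IsUpperSemiFredholm (((1 - t : ℝ) : 𝕜) • T + (t : 𝕜) • J)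
  · exact ⟨J, Or.inl (JoinedIn.refl hJ), exists_homotopicInEmb_restrict_of_segment h⟩
  push Not at h
  obtain ⟨t, ⟨ht0, ht1⟩, hN⟩ := h
  have ht0' : t ≠ 0 := by
    rintro rfl
    exact hN (by simpa using hT.isUpperSemiFredholm)
  have ht1' : t ≠ 1 := by
    rintro rfl
    exact hN (by simpa using hJ.isUpperSemiFredholm)
  have hpos : 0 < 1 - t := sub_pos.2 (lt_of_le_of_ne ht1 ht1')
  have ha : 0 < t / (1 - t) := div_pos (lt_of_le_of_ne ht0 ht0'.symm) hpos
  set a := t / (1 - t) with ha_def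
  -- The bad point of the segment, divided by `1 - t`.
  have hN' : ¬ IsUpperSemiFredholm (T + (a : 𝕜) • J) := by
    intro h
    refine hN (IsUpperSemiFredholm.of_smul (a := (((1 - t)⁻¹ : ℝ) : 𝕜)) ?_)
    have e : (((1 - t)⁻¹ : ℝ) : 𝕜) • (((1 - t : ℝ) : 𝕜) • T + (t : 𝕜) • J) = T + (a : 𝕜) • J := by
      rw [smul_add, smul_smul, smul_smul, ← RCLike.ofReal_mul, ← RCLike.ofReal_mul,
        inv_mul_cancel₀ hpos.ne', ha_def, div_eq_inv_mul]
      simp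
    rwa [e]
  refine ⟨(-a : 𝕜) • J, Or.inr (homotopicInEmb_smul_neg hJ ha),
    exists_homotopicInEmb_restrict_of_segment fun u hu => ?_⟩
  by_contra hcon
  -- A bad point of the segment from `T` to `-aJ`, plus this multiple of the bad operator `T + aJ`,
  -- is the into isomorphism `-aJ`, contrary to stability under sums.
  have hB : ¬ IsUpperSemiFredholm ((-(1 - u : ℝ) : 𝕜) • (T + (a : 𝕜) • J)) :=
    fun h => hN' h.of_smul
  refine not_isUpperSemiFredholm_add hY hcon hB ?_
  have e : ((1 - u : ℝ) : 𝕜) • T + (u : 𝕜) • (-a : 𝕜) • J +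
      (-(1 - u : ℝ) : 𝕜) • (T + (a : 𝕜) • J) = (-a : 𝕜) • J := by
    push_cast
    module
  rw [e]
  exact (hJ.smul (by simpa using ha.ne')).isUpperSemiFredholm

end FredholmAlternative

/-! ### Homotopy classes and connected components. -/

section Components

variable {𝕜 : Type*} [RCLike 𝕜]
variable {Y X : Type*} [NormedAddCommGroup Y] [NormedSpace 𝕜 Y]
  [NormedAddCommGroup X] [NormedSpace 𝕜 X]

theorem homotopicInEmb_neg_of_complex (hI : RCLike.im (RCLike.I : 𝕜) = 1) {J : Y →L[𝕜] X}
    (hJ : IsIntoIsomorphism J) : HomotopicInEmb (-J) J := by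
  have hI0 : (RCLike.I : 𝕜) ≠ 0 := by
    intro h
    simp [h] at hI
  have key : ∀ J : Y →L[𝕜] X, IsIntoIsomorphism J →
      HomotopicInEmb J ((RCLike.I : 𝕜) • J) := by
    intro J hJ
    refine homotopicInEmb_of_line
      (fun t : ℝ => (((1 - t : ℝ) : 𝕜) + (t : 𝕜) * RCLike.I) • J) (by fun_prop)
      (by simp) (by simp) fun t ht => hJ.smul fun h => ?_
    have h1 := congrArg RCLike.re h
    have h2 := congrArg RCLike.im h
    simp [hI] at h1 h2
    linarith
  have h1 := key _ (hJ.smul hI0)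
  rw [smul_smul, RCLike.I_mul_I_of_nonzero hI0, neg_one_smul] at h1
  exact ((key J hJ).trans h1).symm

theorem IsHereditarilyIndecomposable.homotopicInEmb_cases [CompleteSpace Y] [CompleteSpace X]
    (hY : IsHereditarilyIndecomposable 𝕜 Y) {J T : Y →L[𝕜] X} (hJ : IsIntoIsomorphism J)
    (hT : IsIntoIsomorphism T) :
    HomotopicInEmb T J ∨ HomotopicInEmb T (-J) ∨
      (∀ R : Y →L[𝕜] Y, IsReflectionOperator R → HomotopicInEmb T (J ∘L R)) ∨
      (∀ A : Y →L[𝕜] Y, IsAntireflectionOperator A → HomotopicInEmb T (J ∘L A)) := by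
  obtain ⟨B, hB, s, hs⟩ := hY.exists_homotopicInEmb_restrict hJ hT
  have hBe : IsIntoIsomorphism B := by
    rcases hB with h | h <;> exact h.source_mem
  rcases homotopicInEmb_or_reflection_of_restrict hT s B hBe hs with h | ⟨R, hR, h⟩
  · exact (hB.imp h.trans h.trans).imp_right Or.inl
  · right; right
    refine hB.imp ?_ ?_
    · intro hBJ R' hR'
      exact (h.trans (hBJ.comp_right hR.isIntoIsomorphism)).trans
        ((hR.homotopicInEmb hR').comp_left hJ)
    · rintro hBJ _ ⟨R', hR', rfl⟩
      have e : J ∘L (-R') = (-J) ∘L R' := by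
        ext
        simp
      rw [e]
      exact (h.trans (hBJ.comp_right hR.isIntoIsomorphism)).trans
        ((hR.homotopicInEmb hR').comp_left hJ.neg)

theorem IsHereditarilyIndecomposable.homotopicInEmb_or_neg [CompleteSpace Y] [CompleteSpace X]
    (hY : IsHereditarilyIndecomposable 𝕜 Y) {J T : Y →L[𝕜] X} (hJ : IsIntoIsomorphism J)
    (hT : IsIntoIsomorphism T)
    (h : RCLike.im (RCLike.I : 𝕜) = 1 ∨ ¬ Function.Surjective J) :
    HomotopicInEmb T J ∨ HomotopicInEmb T (-J) := by
  obtain ⟨B, hB, s, hs⟩ := hY.exists_homotopicInEmb_restrict hJ hT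
  have hBe : IsIntoIsomorphism B := by
    rcases hB with h | h <;> exact h.source_mem
  have h' : RCLike.im (RCLike.I : 𝕜) = 1 ∨ ¬ Function.Surjective (-J) := by
    refine h.imp_right fun hns hs => hns fun x => ?_
    obtain ⟨y, hy⟩ := hs (-x)
    exact ⟨y, by simpa using hy⟩
  rcases homotopicInEmb_or_reflection_of_restrict hT s B hBe hs with h1 | ⟨R, hR, h1⟩
  · exact hB.imp h1.trans h1.trans
  · refine hB.imp (fun hBJ => ?_) fun hBJ => ?_
    · exact (h1.trans (hBJ.comp_right hR.isIntoIsomorphism)).trans (hR.homotopicInEmb_comp hJ h)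
    · exact (h1.trans (hBJ.comp_right hR.isIntoIsomorphism)).trans
        (hR.homotopicInEmb_comp hJ.neg h')

theorem IsHereditarilyIndecomposable.homotopicInEmb_of_complex [CompleteSpace Y] [CompleteSpace X]
    (hY : IsHereditarilyIndecomposable 𝕜 Y) {J T : Y →L[𝕜] X} (hJ : IsIntoIsomorphism J)
    (hT : IsIntoIsomorphism T) (hI : RCLike.im (RCLike.I : 𝕜) = 1) : HomotopicInEmb T J := by
  rcases hY.homotopicInEmb_or_neg hJ hT (Or.inl hI) with h | h
  · exact h
  · exact h.trans (homotopicInEmb_neg_of_complex hI hJ)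

/-- Choosing for each component an element of `s` homotopic to one of its members is injective,
since homotopic operators lie in the same component. -/
theorem card_connectedComponents_emb_le (s : Finset (Y →L[𝕜] X))
    (h : ∀ T : Y →L[𝕜] X, IsIntoIsomorphism T → ∃ B ∈ s, HomotopicInEmb T B) :
    ENat.card (ConnectedComponents (Emb 𝕜 Y X)) ≤ s.card := by
  have hsurj : ∀ c : ConnectedComponents (Emb 𝕜 Y X), ∃ B : s, ∃ T : Emb 𝕜 Y X,
      (T : ConnectedComponents (Emb 𝕜 Y X)) = c ∧ HomotopicInEmb (T : Y →L[𝕜] X) B := by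
    intro c
    obtain ⟨T, rfl⟩ := ConnectedComponents.surjective_coe c
    obtain ⟨B, hB, hTB⟩ := h T T.2
    exact ⟨⟨B, hB⟩, T, rfl, hTB⟩
  choose g T hT hTg using hsurj
  have hg : Function.Injective g := by
    intro c c' hcc
    have h1 : HomotopicInEmb (T c : Y →L[𝕜] X) (T c') := by
      have h2 := hTg c'
      rw [← hcc] at h2
      exact (hTg c).trans h2.symm
    rw [← hT c, ← hT c', ConnectedComponents.coe_eq_coe']
    exact pathComponent_subset_component _ h1.joined_subtype.symm
  have := ENat.card_le_card_of_injective hg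
  simpa using this

end Components

end EmbeddingsOfHereditarilyIndecomposableSpaces

/-- The hypothesis `RCLike.im (RCLike.I : 𝕜) = 1` says that the scalar field is `ℂ` (for `𝕜 = ℝ` one
has `RCLike.I = 0`). -/
theorem mainTheorem6 {𝕜 : Type*} [RCLike 𝕜]
    {X : Type*} [NormedAddCommGroup X] [NormedSpace 𝕜 X] [CompleteSpace X] :
    (∀ Y : Submodule 𝕜 X, IsClosed (Y : Set X) → IsHereditarilyIndecomposable 𝕜 Y →
      ∀ T : Y →L[𝕜] X, IsIntoIsomorphism T →
        (HomotopicInEmb T Y.subtypeL ∨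
          HomotopicInEmb T (-Y.subtypeL) ∨
          (∀ R : Y →L[𝕜] Y, IsReflectionOperator R → HomotopicInEmb T (Y.subtypeL ∘L R)) ∨
          (∀ A : Y →L[𝕜] Y, IsAntireflectionOperator A → HomotopicInEmb T (Y.subtypeL ∘L A))) ∧
        (Y ≠ ⊤ → HomotopicInEmb T Y.subtypeL ∨ HomotopicInEmb T (-Y.subtypeL)) ∧
        (RCLike.im (RCLike.I : 𝕜) = 1 → HomotopicInEmb T Y.subtypeL)) ∧
    (∀ (Z : Type*) [NormedAddCommGroup Z] [NormedSpace 𝕜 Z] [CompleteSpace Z],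
      IsHereditarilyIndecomposable 𝕜 Z →
        (Nonempty (Z ≃L[𝕜] X) → ENat.card (ConnectedComponents (Emb 𝕜 Z X)) ≤ 4) ∧
        (IsEmpty (Z ≃L[𝕜] X) → ENat.card (ConnectedComponents (Emb 𝕜 Z X)) ≤ 2) ∧
        (RCLike.im (RCLike.I : 𝕜) = 1 → ENat.card (ConnectedComponents (Emb 𝕜 Z X)) ≤ 1)) := by
  classical
  refine ⟨fun Y hYc hY T hT => ?_, fun Z _ _ _ hZ => ?_⟩
  · have : CompleteSpace Y := hYc.completeSpace_coe
    have hι := isIntoIsomorphism_subtypeL Y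
    refine ⟨hY.homotopicInEmb_cases hι hT, fun hne => hY.homotopicInEmb_or_neg hι hT (Or.inr ?_),
      hY.homotopicInEmb_of_complex hι hT⟩
    intro hs
    refine hne (eq_top_iff.2 fun x _ => ?_)
    obtain ⟨y, rfl⟩ := hs x
    exact y.2
  -- Any into isomorphism `J` plays the role of the inclusion; if there is none, there are no
  -- components.
  · by_cases hne : ∃ J : Z →L[𝕜] X, IsIntoIsomorphism J
    · obtain ⟨J, hJ⟩ := hne
      refine ⟨fun _ => ?_, fun hiso => ?_, fun hI => ?_⟩
      · have hnt : Nontrivial Z := by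
          by_contra hcon
          rw [not_nontrivial_iff_subsingleton] at hcon
          exact hZ.1 inferInstance
        obtain ⟨x, hx⟩ := exists_ne (0 : Z)
        obtain ⟨φ, hφ⟩ := SeparatingDual.exists_eq_one (R := 𝕜) hx
        have hR := isReflectionOperator_reflectionAlong hφ
        set R := reflectionAlong φ x
        refine (card_connectedComponents_emb_le {J, -J, J ∘L R, J ∘L (-R)} fun T hT => ?_).trans
          (by exact_mod_cast Finset.card_le_four)
        rcases hZ.homotopicInEmb_cases hJ hT with h | h | h | h
        · exact ⟨_, by simp, h⟩
        · exact ⟨-J, by simp, h⟩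
        · exact ⟨J ∘L R, by simp, h R hR⟩
        · exact ⟨J ∘L (-R), by simp, h _ ⟨R, hR, rfl⟩⟩
      · have hns : ¬ Function.Surjective J := fun hs => hiso.false
          (ContinuousLinearEquiv.ofBijective J (LinearMap.ker_eq_bot.2 hJ.injective)
            (LinearMap.range_eq_top.2 hs))
        refine (card_connectedComponents_emb_le {J, -J} fun T hT => ?_).trans
          (by exact_mod_cast Finset.card_le_two)
        rcases hZ.homotopicInEmb_or_neg hJ hT (Or.inr hns) with h | h
        · exact ⟨_, by simp, h⟩
        · exact ⟨-J, by simp, h⟩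
      · refine (card_connectedComponents_emb_le {J} fun T hT => ?_).trans (by simp)
        exact ⟨J, by simp, hZ.homotopicInEmb_of_complex hJ hT hI⟩
    · have h0 := card_connectedComponents_emb_le (∅ : Finset (Z →L[𝕜] X))
        fun T hT => (hne ⟨T, hT⟩).elim
      simp only [Finset.card_empty, Nat.cast_zero] at h0
      exact ⟨fun _ => h0.trans (by simp), fun _ => h0.trans (by simp), fun _ => h0.trans (by simp)⟩
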